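/- Let $n\ge 0$, $M\ge 1$ and $N_0\ge 1$ be integers, let $\Sigma=\{1,\dots,M\}$, let $C\subset\mathbb R^n$ be closed, and for each $\sigma\in\Sigma$ let $F_\sigma:\mathbb R^n\rightrightarrows\mathbb R^n$ be a set-valued map and $z_\sigma^*\in\mathbb R^n$ a point. Assume that for each $\sigma\in\Sigma$: (i) $F_\sigma$ is outer semicontinuous and locally bounded relative to $C$, and $F_\sigma(z)$ is nonempty and convex for every $z\in C$; (ii) the point $z_\sigma^*$ is globally asymptotically stable for the constrained differential inclusion $\dot z\in F_\sigma(z)$, $z\in C$. That is, for each $\varepsilon>0$ there is $\delta>0$ such that every solution with $|z(0)-z_\sigma^*|\le\delta$ satisfies $|z(t)-z_\sigma^*|\le\varepsilon$ for all $t$ in its domain; and every solution is bounded and, if it is complete (its domain is unbounded), converges to $z_\sigma^*$. Let $\hat{\mathcal H}_0$ be the hybrid system with state $x=(z,\sigma,\tau)\in\mathbb R^{n+2}$ given by $$(z,\sigma,\tau)\in C\times\Sigma\times[0,N_0]:\quad \dot z\in F_\sigma(z),\ \ \dot\sigma=0,\ \ \dot\tau=0,$$ $$(z,\sigma,\tau)\in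 C\times\Sigma\times[1,N_0]:\quad z^+=z,\ \ \sigma^+\in\Sigma\setminus\{\sigma\},\ \ \tau^+=\tau-1.$$ Here solutions are hybrid arcs on hybrid time domains, locally absolutely continuous during flows. Then $\hat{\mathcal H}_0$ is Lagrange stable: there is a continuous, strictly increasing function $\alpha:\mathbb R_{\ge0}\to\mathbb R_{\ge0}$ such that for each $x_0\in\mathbb R^{n+2}$, each solution $x$ of $\hat{\mathcal H}_0$ with $x(0,0)=x_0$ and each $(t,j)\in\operatorname{dom}(x)$, $|x(t,j)|\le\alpha(|x_0|)$. -/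

import Mathlib

open Set Filter Topology MeasureTheory
open scoped NNReal

/-! Hybrid systems `x ∈ C, ẋ ∈ F(x)`; `x ∈ D, x⁺ ∈ G(x)`. -/

/-- The data `(C, F, D, G)` of a hybrid system on the state space `X`. -/
structure HybridSystem (X : Type*) where
  /-- the flow set -/
  flowSet : Set X
  /-- the set-valued flow map -/
  flowMap : X → Set X
  /-- the jump set -/
  jumpSet : Set X
  /-- the set-valued jump map -/
  jumpMap : X → Set X

/-- `E` is a compact hybrid time domain: `E = ⋃_{j < J} [t_j, t_{j+1}] × {j}` for a finite sequence
`0 = t_0 ≤ t_1 ≤ ⋯ ≤ t_J`. -/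
def IsCompactHybridTimeDomain (E : Set (ℝ × ℕ)) : Prop :=
  ∃ (J : ℕ) (t : ℕ → ℝ), t 0 = 0 ∧ (∀ j < J, t j ≤ t (j + 1)) ∧
    E = ⋃ j ∈ Iio J, Icc (t j) (t (j + 1)) ×ˢ {j}

/-- `E ⊆ ℝ≥0 × ℕ` is a hybrid time domain: each truncation `E ∩ ([0,T] × {0,…,J})` with
`(T, J) ∈ E` is a compact hybrid time domain. -/
def IsHybridTimeDomain (E : Set (ℝ × ℕ)) : Prop :=
  (∀ p ∈ E, 0 ≤ p.1) ∧
    ∀ p ∈ E, IsCompactHybridTimeDomain (E ∩ (Icc 0 p.1 ×ˢ Iic p.2))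

/-- A hybrid arc: a function on a nonempty hybrid time domain that is locally absolutely continuous
in `t` on each interval `I^j = {t | (t, j) ∈ dom}`. Values of `toFun` outside `dom` are
irrelevant. -/
structure HybridArc (X : Type*) [NormedAddCommGroup X] where
  /-- the domain -/
  dom : Set (ℝ × ℕ)
  /-- the values -/
  toFun : ℝ → ℕ → X
  isHybridTimeDomain : IsHybridTimeDomain dom
  nonempty : dom.Nonempty
  locallyAbsolutelyContinuous : ∀ (j : ℕ) (a b : ℝ), (a, j) ∈ dom → (b, j) ∈ dom →
    AbsolutelyContinuousOnInterval (fun t => toFun t j) a b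

namespace HybridArc

variable {X : Type*} [NormedAddCommGroup X]

/-- The interval `I^j = {t | (t, j) ∈ dom}`. -/
def interval (x : HybridArc X) (j : ℕ) : Set ℝ := {t | (t, j) ∈ x.dom}

/-- The initial value `x(0,0)`. -/
def init (x : HybridArc X) : X := x.toFun 0 0

/-- The arc is bounded. -/
def IsBounded (x : HybridArc X) : Prop :=
  ∃ R : ℝ, ∀ p ∈ x.dom, ‖x.toFun p.1 p.2‖ ≤ R

/-- The arc is complete: its domain is unbounded. -/
def IsComplete (x : HybridArc X) : Prop :=
  ∀ R : ℝ, ∃ p ∈ x.dom, R < p.1 + (p.2 : ℝ)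

/-- `|x(t,j)|_A → 0` as `t + j → ∞` along the domain. -/
def ConvergesTo (x : HybridArc X) (A : Set X) : Prop :=
  ∀ ε > 0, ∃ T : ℝ, ∀ p ∈ x.dom, T ≤ p.1 + (p.2 : ℝ) →
    Metric.infDist (x.toFun p.1 p.2) A ≤ ε

end HybridArc

namespace HybridSystem

variable {X : Type*} [NormedAddCommGroup X] [NormedSpace ℝ X]

/-- The arc `x` is a solution of the hybrid system `H`. -/
structure IsSolution (H : HybridSystem X) (x : HybridArc X) : Prop where
  init_mem : x.init ∈ closure H.flowSet ∪ H.jumpSet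
  flow_mem : ∀ j, ∀ t ∈ interior (x.interval j), x.toFun t j ∈ H.flowSet
  flow_deriv : ∀ j, ∀ᵐ t : ℝ, t ∈ interior (x.interval j) →
    ∃ v ∈ H.flowMap (x.toFun t j), HasDerivAt (fun s => x.toFun s j) v t
  jump : ∀ (t : ℝ) (j : ℕ), (t, j) ∈ x.dom → (t, j + 1) ∈ x.dom →
    x.toFun t j ∈ H.jumpSet ∧ x.toFun t (j + 1) ∈ H.jumpMap (x.toFun t j)

/-- The set `S(K)` of solutions that start in `K`. -/
def solutionsFrom (H : HybridSystem X) (K : Set X) : Set (HybridArc X) :=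
  {x | H.IsSolution x ∧ x.init ∈ K}

/-- Lagrange stability: `|x(t,j)| ≤ α(|x₀|)` for all solutions, with a continuous, strictly
increasing `α : ℝ≥0 → ℝ≥0` (`α 0` may be positive). -/
def LagrangeStable (H : HybridSystem X) : Prop :=
  ∃ α : ℝ≥0 → ℝ≥0, Continuous α ∧ StrictMono α ∧
    ∀ x₀ : X, ∀ x ∈ H.solutionsFrom {x₀}, ∀ p ∈ x.dom, ‖x.toFun p.1 p.2‖ ≤ α ‖x₀‖₊

/-- Stability of the set `A`. -/
def StableSet (H : HybridSystem X) (A : Set X) : Prop :=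
  ∀ ε > 0, ∃ δ > 0, ∀ x₀ : X, Metric.infDist x₀ A ≤ δ → ∀ x ∈ H.solutionsFrom {x₀},
    ∀ p ∈ x.dom, Metric.infDist (x.toFun p.1 p.2) A ≤ ε

/-- The initial conditions from which each solution is bounded and, if complete, converges
to `A`. -/
def basinOfAttraction (H : HybridSystem X) (A : Set X) : Set X :=
  {x₀ | ∀ x ∈ H.solutionsFrom {x₀}, x.IsBounded ∧ (x.IsComplete → x.ConvergesTo A)}

/-- Attractivity of the set `A`. -/
def AttractiveSet (H : HybridSystem X) (A : Set X) : Prop :=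
  ∃ δ > 0, ∀ x ∈ H.solutionsFrom {x₀ | Metric.infDist x₀ A ≤ δ},
    x.IsBounded ∧ (x.IsComplete → x.ConvergesTo A)

/-- Global asymptotic stability of the compact set `A`. -/
def GloballyAsymptoticallyStable (H : HybridSystem X) (A : Set X) : Prop :=
  IsCompact A ∧ H.StableSet A ∧ H.AttractiveSet A ∧ H.basinOfAttraction A = univ

end HybridSystem

/-! Set-valued maps and constrained differential inclusions. -/

/-- Outer semicontinuity of a set-valued map relative to `C`. -/
def OuterSemicontinuousRelTo {X : Type*} [TopologicalSpace X] (F : X → Set X) (C : Set X) : Prop :=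
  ∀ x ∈ C, ∀ (u v : ℕ → X) (y : X), (∀ i, u i ∈ C) → (∀ i, v i ∈ F (u i)) →
    Tendsto u atTop (𝓝 x) → Tendsto v atTop (𝓝 y) → y ∈ F x

/-- Local boundedness of a set-valued map relative to `C`. -/
def LocallyBoundedRelTo {X : Type*} [NormedAddCommGroup X] (F : X → Set X) (C : Set X) : Prop :=
  ∀ x ∈ C, ∃ U ∈ 𝓝 x, ∃ R : ℝ, ∀ u ∈ U ∩ C, ∀ v ∈ F u, ‖v‖ ≤ R

/-- The constrained differential inclusion `ż ∈ F(z), z ∈ C`, as a hybrid system without jumps. -/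
def constrainedInclusion {X : Type*} (C : Set X) (F : X → Set X) : HybridSystem X where
  flowSet := C
  flowMap := F
  jumpSet := ∅
  jumpMap := fun _ => ∅

/-- The assumption on one mode: `F` is outer semicontinuous and locally bounded relative to `C`,
with nonempty convex values on `C`, and the point `zs` is globally asymptotically stable for
`ż ∈ F(z), z ∈ C`. -/
structure ModeAssumption {X : Type*} [NormedAddCommGroup X] [NormedSpace ℝ X]
    (C : Set X) (F : X → Set X) (zs : X) : Prop where
  outerSemicontinuous : OuterSemicontinuousRelTo F C
  locallyBounded : LocallyBoundedRelTo F C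
  nonempty : ∀ z ∈ C, (F z).Nonempty
  convex : ∀ z ∈ C, Convex ℝ (F z)
  gas : (constrainedInclusion C F).GloballyAsymptoticallyStable {zs}

/-! The ideal switched system with its dwell-time automaton. -/

/-- The state space `ℝ^{n+2} = ℝⁿ × ℝ × ℝ` of `(z, σ, τ)`, with the Euclidean norm. -/
abbrev SwitchedState (n : ℕ) : Type :=
  WithLp 2 (EuclideanSpace ℝ (Fin n) × WithLp 2 (ℝ × ℝ))

namespace SwitchedState

variable {n : ℕ}

/-- The component `z`. -/
def z (x : SwitchedState n) : EuclideanSpace ℝ (Fin n) := x.fst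

/-- The mode `σ`, a real number. -/
def mode (x : SwitchedState n) : ℝ := x.snd.fst

/-- The timer `τ`. -/
def timer (x : SwitchedState n) : ℝ := x.snd.snd

end SwitchedState

/-- `Σ = {1, …, M}` as a set of reals. -/
def modeSet (M : ℕ) : Set ℝ := (fun k : ℕ => (k : ℝ)) '' Icc 1 M

/-- The ideal hybrid system: during flows `ż ∈ F_σ(z)`, `σ̇ = 0`, `τ̇ = 0` on `C × Σ × [0, N₀]`;
at jumps `z⁺ = z`, `σ⁺ ∈ Σ \ {σ}`, `τ⁺ = τ - 1` on `C × Σ × [1, N₀]`. -/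
def idealSystem {n : ℕ} (M N₀ : ℕ) (C : Set (EuclideanSpace ℝ (Fin n)))
    (F : ℕ → EuclideanSpace ℝ (Fin n) → Set (EuclideanSpace ℝ (Fin n))) :
    HybridSystem (SwitchedState n) where
  flowSet := {x | x.z ∈ C ∧ x.mode ∈ modeSet M ∧ x.timer ∈ Icc 0 (N₀ : ℝ)}
  flowMap := fun x => {v | (∃ k ∈ Icc 1 M, x.mode = (k : ℝ) ∧ v.z ∈ F k x.z) ∧
    v.mode = 0 ∧ v.timer = 0}
  jumpSet := {x | x.z ∈ C ∧ x.mode ∈ modeSet M ∧ x.timer ∈ Icc 1 (N₀ : ℝ)}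
  jumpMap := fun x => {y | y.z = x.z ∧ y.mode ∈ modeSet M \ {x.mode} ∧ y.timer = x.timer - 1}

/-! ### Absolutely continuous curves -/

/-! The timer is constant during flows, drops by one at jumps and stays nonnegative, so there are at
most `N₀` jumps. Jumps leave `z` unchanged, and between jumps `z` solves the inclusion of a single
mode. Hence it suffices that each mode maps a ball of initial points into a bounded set
(`ModeAssumption.exists_uniform_bound`); this bound is iterated at most `N₀ + 1` times
(`norm_le_of_isSolution`).

The uniform bound is a compactness argument. If solutions `y i` from one ball end at points of norm
exceeding `i`, take their pointwise limit along an ultrafilter, on the times up to which they are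
jointly bounded. The limit is a solution (`IsFlowOn.of_tendsto`), hence bounded by asymptotic
stability. A speed bound then extends these times by a fixed step, so the limit exists for all times
and comes close to the equilibrium. So does some `y i` with a far endpoint, and stability forbids
that endpoint. -/

theorem LipschitzWith.comp_absolutelyContinuousOnInterval {X Y : Type*} [PseudoMetricSpace X]
    [PseudoMetricSpace Y] {K : ℝ≥0} {g : X → Y} (hg : LipschitzWith K g) {f : ℝ → X} {a b : ℝ}
    (hf : AbsolutelyContinuousOnInterval f a b) :
    AbsolutelyContinuousOnInterval (fun t => g (f t)) a b := by
  have h : Tendsto (fun E : ℕ × (ℕ → ℝ × ℝ) =>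
      (K : ℝ) * ∑ i ∈ Finset.range E.1, dist (f (E.2 i).1) (f (E.2 i).2))
      (AbsolutelyContinuousOnInterval.totalLengthFilter ⊓
        𝓟 (AbsolutelyContinuousOnInterval.disjWithin a b)) (𝓝 0) := by
    simpa using Tendsto.const_mul (K : ℝ) hf
  refine squeeze_zero (fun E => Finset.sum_nonneg fun i _ => dist_nonneg) (fun E => ?_) h
  rw [Finset.mul_sum]
  exact Finset.sum_le_sum fun i _ => hg.dist_le_mul _ _

theorem AbsolutelyContinuousOnInterval.comp_add_const {X : Type*} [PseudoMetricSpace X]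
    {f : ℝ → X} {a b : ℝ} (hf : AbsolutelyContinuousOnInterval f a b) (c : ℝ) :
    AbsolutelyContinuousOnInterval (fun t => f (t + c)) (a - c) (b - c) := by
  rw [absolutelyContinuousOnInterval_iff] at hf ⊢
  intro ε hε
  obtain ⟨δ, hδ, h⟩ := hf ε hε
  refine ⟨δ, hδ, fun E hE hlen => ?_⟩
  refine h (E.1, fun i => ((E.2 i).1 + c, (E.2 i).2 + c)) ⟨fun i hi => ?_, ?_⟩ ?_
  · have := hE.1 i hi
    simp only [mem_uIcc] at this ⊢
    constructor
    · rcases this.1 with h | h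
      · exact Or.inl ⟨by linarith [h.1], by linarith [h.2]⟩
      · exact Or.inr ⟨by linarith [h.1], by linarith [h.2]⟩
    · rcases this.2 with h | h
      · exact Or.inl ⟨by linarith [h.1], by linarith [h.2]⟩
      · exact Or.inr ⟨by linarith [h.1], by linarith [h.2]⟩
  · intro i hi j hj hij
    have hd := Set.disjoint_left.1 (hE.2 hi hj hij)
    refine Set.disjoint_left.2 fun x hx hx' => hd (a := x - c) ?_ ?_
    · simp only [mem_uIoc] at hx ⊢
      rcases hx with h | h
      · exact Or.inl ⟨by linarith [h.1], by linarith [h.2]⟩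
      · exact Or.inr ⟨by linarith [h.1], by linarith [h.2]⟩
    · simp only [mem_uIoc] at hx' ⊢
      rcases hx' with h | h
      · exact Or.inl ⟨by linarith [h.1], by linarith [h.2]⟩
      · exact Or.inr ⟨by linarith [h.1], by linarith [h.2]⟩
  · simpa using hlen

section

variable {E : Type*} [NormedAddCommGroup E] [NormedSpace ℝ E]

/-- A mean value theorem: if the derivative lies almost everywhere in a closed convex set, so does
the difference quotient. -/
theorem AbsolutelyContinuousOnInterval.slope_mem_of_ae_hasDerivAt_mem {f : ℝ → E} {a b : ℝ}
    (hf : AbsolutelyContinuousOnInterval f a b) (hab : a < b) {K : Set E} (hK : Convex ℝ K)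
    (hKc : IsClosed K)
    (hd : ∀ᵐ t : ℝ, t ∈ Ioo a b → ∃ v ∈ K, HasDerivAt f v t) :
    (b - a)⁻¹ • (f b - f a) ∈ K := by
  by_contra hp
  -- A functional separating the quotient from `K` contradicts the fundamental theorem of calculus
  -- for `φ ∘ f`.
  obtain ⟨φ, u, hu, hup⟩ := geometric_hahn_banach_closed_point hK hKc hp
  have hφ := φ.lipschitz.comp_absolutelyContinuousOnInterval hf
  have hint := hφ.integral_deriv_eq_sub
  have hle : ∫ t in a..b, deriv (fun t => φ (f t)) t ≤ ∫ _ in a..b, u := by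
    refine intervalIntegral.integral_mono_ae_restrict hab.le hφ.intervalIntegrable_deriv
      intervalIntegrable_const ?_
    rw [Measure.restrict_congr_set Ioo_ae_eq_Icc.symm]
    refine (ae_restrict_iff' measurableSet_Ioo).2 (hd.mono fun t ht htm => ?_)
    obtain ⟨v, hv, hvd⟩ := ht htm
    have : HasDerivAt (fun t => φ (f t)) (φ v) t := φ.hasFDerivAt.comp_hasDerivAt t hvd
    rw [this.deriv]
    exact (hu v hv).le
  rw [hint, intervalIntegral.integral_const, smul_eq_mul] at hle
  rw [map_smul, map_sub, smul_eq_mul, ← div_eq_inv_mul, lt_div_iff₀ (by linarith)] at hup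
  linarith

theorem AbsolutelyContinuousOnInterval.norm_sub_le_of_ae_hasDerivAt {f : ℝ → E} {a b L : ℝ}
    (hf : AbsolutelyContinuousOnInterval f a b) (hab : a ≤ b)
    (hd : ∀ᵐ t : ℝ, t ∈ Ioo a b → ∃ v : E, ‖v‖ ≤ L ∧ HasDerivAt f v t) :
    ‖f b - f a‖ ≤ L * (b - a) := by
  rcases hab.eq_or_lt with rfl | hab
  · simp
  have := hf.slope_mem_of_ae_hasDerivAt_mem hab (convex_closedBall (0 : E) L)
    Metric.isClosed_closedBall (by simpa using hd)
  have hba : 0 < b - a := by linarith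
  rw [mem_closedBall_zero_iff, norm_smul, norm_inv, Real.norm_of_nonneg hba.le,
    ← div_eq_inv_mul, div_le_iff₀ hba] at this
  exact this

/-! ### Solutions of a constrained differential inclusion on a compact interval -/

/-- `z` is an absolutely continuous solution of `ż ∈ F(z)`, `z ∈ C`, on `[a, b]`. -/
structure IsFlowOn (C : Set E) (F : E → Set E) (z : ℝ → E) (a b : ℝ) : Prop where
  ac : AbsolutelyContinuousOnInterval z a b
  mem : ∀ t ∈ Icc a b, z t ∈ C
  deriv : ∀ᵐ t : ℝ, t ∈ Ioo a b → ∃ v ∈ F (z t), HasDerivAt z v t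

namespace IsFlowOn

variable {C : Set E} {F : E → Set E} {z : ℝ → E} {a b : ℝ}

theorem mono (h : IsFlowOn C F z a b) {c d : ℝ} (hac : a ≤ c) (hcd : c ≤ d) (hdb : d ≤ b) :
    IsFlowOn C F z c d where
  ac := h.ac.mono (by
    rw [uIcc_of_le hcd, uIcc_of_le (hac.trans (hcd.trans hdb))]
    exact Icc_subset_Icc hac hdb)
  mem t ht := h.mem t (Icc_subset_Icc hac hdb ht)
  deriv := h.deriv.mono fun t ht htm => ht (Ioo_subset_Ioo hac hdb htm)

theorem comp_add_const (h : IsFlowOn C F z a b) (c : ℝ) :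
    IsFlowOn C F (fun t => z (t + c)) (a - c) (b - c) where
  ac := h.ac.comp_add_const c
  mem t ht := h.mem _ ⟨by linarith [ht.1], by linarith [ht.2]⟩
  deriv := by
    have := (measurePreserving_add_right (volume : Measure ℝ) c).quasiMeasurePreserving.ae h.deriv
    filter_upwards [this] with t ht htm
    obtain ⟨v, hv, hd⟩ := ht ⟨by linarith [htm.1], by linarith [htm.2]⟩
    exact ⟨v, hv, hd.comp_add_const t c⟩

theorem continuousOn (h : IsFlowOn C F z a b) (hab : a ≤ b) : ContinuousOn z (Icc a b) := by
  simpa [uIcc_of_le hab] using h.ac.continuousOn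

theorem norm_sub_le (h : IsFlowOn C F z a b) {L : ℝ} (hab : a ≤ b)
    (hL : ∀ t ∈ Ioo a b, ∀ v ∈ F (z t), ‖v‖ ≤ L) : ‖z b - z a‖ ≤ L * (b - a) :=
  h.ac.norm_sub_le_of_ae_hasDerivAt hab <| h.deriv.mono fun t ht htm =>
    let ⟨v, hv, hd⟩ := ht htm
    ⟨v, hL t htm v hv, hd⟩

/-- A solution with `‖z a‖ ≤ R` stays in the ball of radius `R + 1` for the time `1 / (L + 1)`, if
`L` bounds the speed in that ball. -/
theorem norm_le_add_one (h : IsFlowOn C F z a b) {L R : ℝ} (hL0 : 0 ≤ L)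
    (hL : ∀ u ∈ C, ‖u‖ ≤ R + 1 → ∀ v ∈ F u, ‖v‖ ≤ L) (ha : ‖z a‖ ≤ R)
    (hb : b ≤ a + 1 / (L + 1)) (t : ℝ) (ht : t ∈ Icc a b) : ‖z t‖ ≤ R + 1 := by
  by_contra! hlt
  have hat := h.mono le_rfl ht.1 ht.2
  -- Before the first time `s` at which the norm reaches `R + 1`, the speed is at most `L`, so the
  -- distance covered is at most `L / (L + 1) < 1`.
  have hc : IsCompact {s | s ∈ Icc a t ∧ R + 1 ≤ ‖z s‖} := by
    have := (hat.continuousOn ht.1).norm.preimage_isClosed_of_isClosed isClosed_Icc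
      (isClosed_Ici (a := R + 1))
    exact isCompact_Icc.of_isClosed_subset this fun s hs => hs.1
  obtain ⟨s, ⟨hs, hsR⟩, hmin⟩ := hc.exists_isLeast ⟨t, ⟨ht.1, le_rfl⟩, hlt.le⟩
  have hsub := (hat.mono le_rfl hs.1 hs.2).norm_sub_le (L := L) hs.1 fun τ hτ v hv => by
    refine hL _ (hat.mem τ ⟨hτ.1.le, hτ.2.le.trans hs.2⟩) ?_ v hv
    by_contra! hτR
    exact absurd (hmin ⟨⟨hτ.1.le, hτ.2.le.trans hs.2⟩, hτR.le⟩) (not_le.2 hτ.2)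
  have h1 : L * (s - a) ≤ L * (1 / (L + 1)) :=
    mul_le_mul_of_nonneg_left (by linarith [hs.2, ht.2]) hL0
  have h2 : L * (1 / (L + 1)) < 1 := by
    rw [mul_one_div, div_lt_one (by linarith)]; linarith
  have h3 : ‖z s‖ ≤ ‖z a‖ + ‖z s - z a‖ := by
    simpa using norm_add_le (z a) (z s - z a)
  linarith

end IsFlowOn

end

/-! ### Set-valued maps -/

theorem LocallyBoundedRelTo.exists_bound_of_isCompact {E : Type*}
    [NormedAddCommGroup E] {C K : Set E} {F : E → Set E}
    (hF : LocallyBoundedRelTo F C) (hK : IsCompact K) (hKC : K ⊆ C) :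
    ∃ L : ℝ, 0 ≤ L ∧ ∀ u ∈ K, ∀ v ∈ F u, ‖v‖ ≤ L := by
  refine hK.induction_on (p := fun s => ∃ L : ℝ, 0 ≤ L ∧ ∀ u ∈ s, ∀ v ∈ F u, ‖v‖ ≤ L)
    ⟨0, le_rfl, by simp⟩ ?_ ?_ ?_
  · rintro s t hst ⟨L, h0, hL⟩
    exact ⟨L, h0, fun u hu => hL u (hst hu)⟩
  · rintro s t ⟨L, h0, hL⟩ ⟨L', h0', hL'⟩
    refine ⟨max L L', h0.trans (le_max_left _ _), ?_⟩
    rintro u (hu | hu) v hv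
    · exact (hL u hu v hv).trans (le_max_left _ _)
    · exact (hL' u hu v hv).trans (le_max_right _ _)
  · intro x hx
    obtain ⟨U, hU, R, hR⟩ := hF x (hKC hx)
    refine ⟨K ∩ U, inter_mem self_mem_nhdsWithin (mem_nhdsWithin_of_mem_nhds hU), max R 0,
      le_max_right _ _, fun u hu v hv => (hR u ⟨hu.2, hKC hu.1⟩ v hv).trans (le_max_left _ _)⟩

theorem OuterSemicontinuousRelTo.isClosed {E : Type*} [NormedAddCommGroup E]
    {C : Set E} {F : E → Set E}
    (hF : OuterSemicontinuousRelTo F C) {x : E} (hx : x ∈ C) : IsClosed (F x) :=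
  isClosed_of_closure_subset fun y hy => by
    obtain ⟨v, hv, hvy⟩ := mem_closure_iff_seq_limit.1 hy
    exact hF x hx (fun _ => x) v y (fun _ => hx) hv tendsto_const_nhds hvy

/-- Otherwise there are values outside the thickening at points tending to `x`. Local boundedness
gives a convergent subsequence, and outer semicontinuity puts its limit in `F x`. -/
theorem OuterSemicontinuousRelTo.exists_subset_cthickening {E : Type*}
    [NormedAddCommGroup E] [NormedSpace ℝ E] [FiniteDimensional ℝ E]
    {C : Set E} {F : E → Set E}
    (hF : OuterSemicontinuousRelTo F C) (hb : LocallyBoundedRelTo F C) {x : E} (hx : x ∈ C)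
    {ε : ℝ} (hε : 0 < ε) :
    ∃ η > 0, ∀ u ∈ C, dist u x < η → F u ⊆ Metric.cthickening ε (F x) := by
  by_contra! hcon
  obtain ⟨U, hU, R, hR⟩ := hb x hx
  have hpos : ∀ n : ℕ, (0 : ℝ) < 1 / (n + 1) := fun n => Nat.one_div_pos_of_nat
  choose u huC hux hun using fun n : ℕ => hcon _ (hpos n)
  choose v hv hvn using fun n => Set.not_subset.1 (hun n)
  have hu : Tendsto u atTop (𝓝 x) :=
    tendsto_iff_dist_tendsto_zero.2 <| squeeze_zero (fun _ => dist_nonneg) (fun n => (hux n).le)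
      tendsto_one_div_add_atTop_nhds_zero_nat
  have hvR : ∃ᶠ n in atTop, v n ∈ Metric.closedBall (0 : E) R :=
    ((hu.eventually_mem hU).mono fun n hn => by
      simpa using hR _ ⟨hn, huC n⟩ _ (hv n)).frequently
  have : ProperSpace E := FiniteDimensional.proper ℝ E
  obtain ⟨y, -, φ, hφ, hy⟩ := tendsto_subseq_of_frequently_bounded
    (Metric.isBounded_closedBall (x := (0 : E)) (r := R)) hvR
  have hyF : y ∈ F x := hF x hx (u ∘ φ) (v ∘ φ) y (fun i => huC _) (fun i => hv _)
    (hu.comp hφ.tendsto_atTop) hy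
  obtain ⟨n, hn⟩ := (Metric.tendsto_atTop.1 hy ε hε)
  exact hvn (φ n) (Metric.mem_cthickening_of_dist_le _ y _ _ hyF (hn n le_rfl).le)

section

variable {E : Type*} [NormedAddCommGroup E] [NormedSpace ℝ E]
  {C : Set E} {F : E → Set E} {z : ℝ → E} {zs : E}

/-! ### Limits of solutions -/

/-- The closure theorem: a pointwise limit of uniformly bounded solutions is a solution. -/
theorem IsFlowOn.of_tendsto [FiniteDimensional ℝ E] (hC : IsClosed C)
    (hosc : OuterSemicontinuousRelTo F C) (hlb : LocallyBoundedRelTo F C)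
    (hcv : ∀ x ∈ C, Convex ℝ (F x)) {ι : Type*} {l : Filter ι} [l.NeBot] {y : ι → ℝ → E}
    {a b R : ℝ} (hab : a ≤ b)
    (hy : ∀ᶠ i in l, IsFlowOn C F (y i) a b ∧ ∀ s ∈ Icc a b, ‖y i s‖ ≤ R)
    (hlim : ∀ s ∈ Icc a b, Tendsto (fun i => y i s) l (𝓝 (z s))) :
    IsFlowOn C F z a b := by
  have : ProperSpace E := FiniteDimensional.proper ℝ E
  -- One `L` bounds the speed of all the `y i`, so the limit is Lipschitz and differentiable almost
  -- everywhere.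
  obtain ⟨L, hL0, hL⟩ := hlb.exists_bound_of_isCompact
    ((isCompact_closedBall (0 : E) R).inter_left hC) inter_subset_left
  have hyL : ∀ᶠ i in l, ∀ s ∈ Icc a b, ∀ t ∈ Icc a b, s ≤ t → ‖y i t - y i s‖ ≤ L * (t - s) := by
    filter_upwards [hy] with i ⟨hi, hiR⟩ s hs t ht hst
    refine (hi.mono hs.1 hst ht.2).norm_sub_le hst fun τ hτ v hv => ?_
    have hτ' : τ ∈ Icc a b := ⟨hs.1.trans hτ.1.le, hτ.2.le.trans ht.2⟩
    exact hL _ ⟨hi.mem τ hτ', by simpa using hiR τ hτ'⟩ v hv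
  have hzL : ∀ s ∈ Icc a b, ∀ t ∈ Icc a b, s ≤ t → ‖z t - z s‖ ≤ L * (t - s) :=
    fun s hs t ht hst => le_of_tendsto ((hlim t ht).sub (hlim s hs)).norm
      (hyL.mono fun i hi => hi s hs t ht hst)
  have hzlip : LipschitzOnWith L.toNNReal z (Icc a b) := by
    refine LipschitzOnWith.of_dist_le_mul fun s hs t ht => ?_
    rw [Real.coe_toNNReal _ hL0]
    rcases le_total s t with h | h
    · rw [dist_comm, dist_eq_norm, dist_comm, Real.dist_eq, abs_of_nonneg (by linarith)]
      exact hzL s hs t ht h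
    · rw [dist_eq_norm, Real.dist_eq, abs_of_nonneg (by linarith)]
      exact hzL t ht s hs h
  have hzC : ∀ t ∈ Icc a b, z t ∈ C := fun t ht =>
    hC.mem_of_tendsto (hlim t ht) (hy.mono fun i hi => hi.1.mem t ht)
  refine ⟨(LipschitzOnWith.absolutelyContinuousOnInterval (by rwa [uIcc_of_le hab])), hzC, ?_⟩
  filter_upwards [hzlip.ae_differentiableWithinAt_of_mem_real] with t htd ht
  have ht' := Ioo_subset_Icc_self ht
  have hd := ((htd ht').differentiableAt (Icc_mem_nhds ht.1 ht.2)).hasDerivAt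
  refine ⟨_, ?_, hd⟩
  -- Since `F (z t)` is closed, it is enough to put the derivative in each closed thickening. This
  -- takes two limits: difference quotients of `y i` pass to those of `z`, and then `s` tends to
  -- `t`.
  rw [← (hosc.isClosed (hzC t ht')).closure_eq, Metric.closure_eq_iInter_cthickening]
  refine mem_iInter₂.2 fun ε hε => ?_
  obtain ⟨η, hη, hF⟩ := hosc.exists_subset_cthickening hlb (hzC t ht') hε
  have hK : IsClosed (Metric.cthickening ε (F (z t))) := Metric.isClosed_cthickening
  refine hK.mem_of_tendsto
    ((hasDerivWithinAt_iff_tendsto_slope' self_notMem_Ioi).1 hd.hasDerivWithinAt) ?_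
  -- Half of `η` pays for the motion of `y i` on `[t, s]`, the other half for the distance from `y i
  -- t` to `z t`.
  have hnear : ∀ᶠ s in 𝓝[>] t, L * (s - t) < η / 2 := by
    have : Tendsto (fun s => L * (s - t)) (𝓝 t) (𝓝 (L * (t - t))) := by
      apply Continuous.tendsto; fun_prop
    rw [sub_self, mul_zero] at this
    exact mem_nhdsWithin_of_mem_nhds (this.eventually_lt_const (by linarith))
  filter_upwards [hnear, self_mem_nhdsWithin, mem_nhdsWithin_of_mem_nhds (Iio_mem_nhds ht.2)]
    with s hsη hts hsb
  have hts : t < s := hts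
  have hs' : s ∈ Icc a b := ⟨ht'.1.trans hts.le, le_of_lt hsb⟩
  refine hK.mem_of_tendsto (f := fun i => (s - t)⁻¹ • (y i s - y i t))
    (((hlim s hs').sub (hlim t ht')).const_smul _) ?_
  filter_upwards [hy, hyL, (Metric.tendsto_nhds.1 (hlim t ht')) (η / 2) (by linarith)]
    with i ⟨hi, _⟩ hiL hit
  have his := hi.mono ht'.1 hts.le hs'.2
  refine his.ac.slope_mem_of_ae_hasDerivAt_mem hts ((hcv _ (hzC t ht')).cthickening ε) hK
    (his.deriv.mono fun τ hτ hτm => ?_)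
  obtain ⟨v, hv, hvd⟩ := hτ hτm
  refine ⟨v, hF (y i τ) (his.mem τ (Ioo_subset_Icc_self hτm)) ?_ hv, hvd⟩
  have h1 := hiL t ht' τ ⟨ht'.1.trans hτm.1.le, hτm.2.le.trans hs'.2⟩ hτm.1.le
  have h2 : L * (τ - t) ≤ L * (s - t) :=
    mul_le_mul_of_nonneg_left (by linarith [hτm.2]) hL0
  calc dist (y i τ) (z t) ≤ dist (y i τ) (y i t) + dist (y i t) (z t) := dist_triangle _ _ _
    _ < η := by rw [dist_eq_norm (y i τ)]; linarith

/-- A solution on an interval that contains its left end `0`, as a hybrid arc without jumps. -/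
def HybridArc.ofFlow {S : Set ℝ} (h0 : 0 ∈ S) (hS : S ⊆ Ici 0)
    (hSc : ∀ t ∈ S, ∀ s, 0 ≤ s → s ≤ t → s ∈ S) (hz : ∀ t ∈ S, IsFlowOn C F z 0 t) :
    HybridArc E where
  dom := S ×ˢ {0}
  toFun t _ := z t
  isHybridTimeDomain := by
    refine ⟨fun p hp => hS hp.1, ?_⟩
    rintro ⟨t, j⟩ ⟨ht, rfl : j = 0⟩
    refine ⟨1, fun j => if j = 0 then 0 else t, by simp, by simpa using hS ht, ?_⟩
    ext ⟨s, j⟩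
    simp only [mem_inter_iff, mem_prod, mem_singleton_iff, mem_Icc, mem_Iic, mem_iUnion, mem_Iio,
      Nat.lt_one_iff, exists_prop, exists_eq_left]
    constructor
    · rintro ⟨⟨-, rfl⟩, hs, -⟩
      exact ⟨by simpa using hs, rfl⟩
    · rintro ⟨hs, rfl⟩
      have hs : 0 ≤ s ∧ s ≤ t := by simpa using hs
      exact ⟨⟨hSc t ht s hs.1 hs.2, rfl⟩, hs, le_rfl⟩
  nonempty := ⟨(0, 0), h0, rfl⟩
  locallyAbsolutelyContinuous := by
    intro j a b ha hb
    have ha' : (0 : ℝ) ≤ a := hS ha.1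
    have hb' : (0 : ℝ) ≤ b := hS hb.1
    rcases le_total a b with hab | hab
    · exact ((hz b hb.1).mono ha' hab le_rfl).ac
    · exact ((hz a ha.1).mono hb' hab le_rfl).ac.symm

theorem HybridArc.isSolution_ofFlow {S : Set ℝ} (h0 : 0 ∈ S) (hS : S ⊆ Ici 0)
    (hSc : ∀ t ∈ S, ∀ s, 0 ≤ s → s ≤ t → s ∈ S) (hz : ∀ t ∈ S, IsFlowOn C F z 0 t) :
    (constrainedInclusion C F).IsSolution (HybridArc.ofFlow h0 hS hSc hz) where
  init_mem := Or.inl (subset_closure ((hz 0 h0).mem 0 (by simp)))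
  flow_mem := fun j t ht => by
    have ht : t ∈ S := (interior_subset ht).1
    exact (hz t ht).mem t ⟨hS ht, le_rfl⟩
  flow_deriv := fun j => by
    -- Rational right ends keep the union of the exceptional null sets countable.
    have hq : ∀ᵐ t : ℝ, ∀ q : ℚ, (q : ℝ) ∈ S → t ∈ Ioo 0 (q : ℝ) →
        ∃ v ∈ F (z t), HasDerivAt z v t := by
      refine ae_all_iff.2 fun q => ?_
      by_cases hqS : (q : ℝ) ∈ S
      · exact (hz q hqS).deriv.mono fun t ht _ => ht
      · exact Eventually.of_forall fun t h => absurd h hqS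
    filter_upwards [hq] with t ht htint
    have htS : interior S ∈ 𝓝 t := isOpen_interior.mem_nhds
      (interior_mono (fun s hs => hs.1) htint)
    obtain ⟨l, u, ⟨hlt, htu⟩, huS⟩ := mem_nhds_iff_exists_Ioo_subset.1 htS
    obtain ⟨q, htq, hqu⟩ := exists_rat_btwn htu
    obtain ⟨p, hlp, hpt⟩ := exists_rat_btwn hlt
    have h0p : (0 : ℝ) ≤ p := hS (interior_subset (huS ⟨hlp, hpt.trans htu⟩))
    exact ht q (interior_subset (huS ⟨hlt.trans htq, hqu⟩)) ⟨h0p.trans_lt hpt, htq⟩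
  jump := fun t j _ h => absurd h.2 (by simp)

/-! ### Uniform boundedness of the solutions of one mode -/

namespace ModeAssumption

/-- `S` may be bounded and open on the right: the basin condition bounds incomplete solutions too,
which excludes blow-up in finite time. -/
theorem exists_bound_of_isFlowOn (hA : ModeAssumption C F zs) {S : Set ℝ} (h0 : 0 ∈ S)
    (hS : S ⊆ Ici 0) (hSc : ∀ t ∈ S, ∀ s, 0 ≤ s → s ≤ t → s ∈ S)
    (hz : ∀ t ∈ S, IsFlowOn C F z 0 t) : ∃ R : ℝ, ∀ t ∈ S, ‖z t‖ ≤ R := by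
  have hb : (HybridArc.ofFlow h0 hS hSc hz).init ∈
    (constrainedInclusion C F).basinOfAttraction {zs} := by
    rw [hA.gas.2.2.2]; trivial
  obtain ⟨R, hR⟩ := (hb _ ⟨HybridArc.isSolution_ofFlow h0 hS hSc hz, rfl⟩).1
  exact ⟨R, fun t ht => hR (t, 0) ⟨ht, rfl⟩⟩

theorem exists_dist_le_of_isFlowOn (hA : ModeAssumption C F zs)
    (hz : ∀ t, 0 ≤ t → IsFlowOn C F z 0 t) {ε : ℝ} (hε : 0 < ε) :
    ∃ t, 0 ≤ t ∧ dist (z t) zs ≤ ε := by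
  have h0 : (0 : ℝ) ∈ Ici (0 : ℝ) := self_mem_Ici
  have hSc : ∀ t ∈ Ici (0 : ℝ), ∀ s, 0 ≤ s → s ≤ t → s ∈ Ici (0 : ℝ) := fun _ _ _ h _ => h
  have hb : (HybridArc.ofFlow h0 Subset.rfl hSc hz).init ∈
    (constrainedInclusion C F).basinOfAttraction {zs} := by
    rw [hA.gas.2.2.2]; trivial
  obtain ⟨T, hT⟩ := (hb _ ⟨HybridArc.isSolution_ofFlow h0 Subset.rfl hSc hz, rfl⟩).2
    (fun R => ⟨(max R 0 + 1, 0), ⟨by simp only [mem_Ici]; positivity, rfl⟩, by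
      simpa using (le_max_left R 0).trans_lt (lt_add_one _)⟩) ε hε
  refine ⟨max T 0, le_max_right _ _, ?_⟩
  have := hT (max T 0, 0) ⟨mem_Ici.2 (le_max_right _ _), rfl⟩ (by simp)
  rwa [Metric.infDist_singleton] at this

/-- The inclusion is autonomous, so stability applies from any starting time `a` after a shift to
`0`. -/
theorem exists_stable_of_isFlowOn (hA : ModeAssumption C F zs) {ε : ℝ} (hε : 0 < ε) :
    ∃ δ > 0, ∀ (z : ℝ → E) (a b : ℝ), a ≤ b → IsFlowOn C F z a b → dist (z a) zs ≤ δ →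
      dist (z b) zs ≤ ε := by
  obtain ⟨δ, hδ, h⟩ := hA.gas.2.1 ε hε
  refine ⟨δ, hδ, fun z a b hab hz hza => ?_⟩
  have hz0 := hz.comp_add_const a
  rw [sub_self] at hz0
  have hsol := HybridArc.isSolution_ofFlow (S := Icc 0 (b - a)) ⟨le_rfl, by linarith⟩
    (fun t ht => ht.1) (fun t ht s h0 hst => ⟨h0, hst.trans ht.2⟩)
    (fun t ht => hz0.mono le_rfl ht.1 ht.2)
  have := h (z (0 + a)) (by simpa using hza) _ ⟨hsol, rfl⟩ (b - a, 0) ⟨⟨by linarith, le_rfl⟩, rfl⟩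
  simpa [HybridArc.ofFlow] using this

/-- Solutions that start in a bounded set are uniformly bounded. -/
theorem exists_uniform_bound [FiniteDimensional ℝ E] (hC : IsClosed C)
    (hA : ModeAssumption C F zs) (r : ℝ) :
    ∃ R : ℝ, ∀ (z : ℝ → E) (T : ℝ), 0 ≤ T → IsFlowOn C F z 0 T → ‖z 0‖ ≤ r → ‖z T‖ ≤ R := by
  have : ProperSpace E := FiniteDimensional.proper ℝ E
  by_contra! hcon
  choose y T hT0 hy hyr hyT using fun i : ℕ => hcon i
  -- Along an ultrafilter bounded sequences converge at all times simultaneously, with no extraction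
  -- of subsequences.
  let 𝒰 : Ultrafilter ℕ := hyperfilter ℕ
  have hlarge : ∀ R : ℝ, ∀ᶠ i in (𝒰 : Filter ℕ), R < ‖y i (T i)‖ := fun R => by
    have h1 : ∀ᶠ i : ℕ in atTop, R < i := tendsto_natCast_atTop_atTop.eventually_gt_atTop R
    have h2 : ∀ᶠ i : ℕ in (𝒰 : Filter ℕ), R < i := by
      refine hyperfilter_le_cofinite ?_
      rwa [Nat.cofinite_eq_atTop]
    exact h2.mono fun i hi => hi.trans (hyT i)
  let S : Set ℝ := {t | 0 ≤ t ∧ ∃ R : ℝ, ∀ᶠ i in (𝒰 : Filter ℕ), t ≤ T i ∧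
    ∀ s ∈ Icc 0 t, ‖y i s‖ ≤ R}
  have h0 : (0 : ℝ) ∈ S := ⟨le_rfl, r, Eventually.of_forall fun i => ⟨hT0 i, fun s hs => by
    rw [le_antisymm hs.2 hs.1]; exact hyr i⟩⟩
  have hS : S ⊆ Ici 0 := fun t ht => ht.1
  have hSc : ∀ t ∈ S, ∀ s, 0 ≤ s → s ≤ t → s ∈ S := by
    rintro t ⟨-, R, hR⟩ s hs hst
    exact ⟨hs, R, hR.mono fun i hi => ⟨hst.trans hi.1, fun τ hτ => hi.2 τ ⟨hτ.1, hτ.2.trans hst⟩⟩⟩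
  have hlim : ∀ t ∈ S, ∃ w : E, Tendsto (fun i => y i t) 𝒰 (𝓝 w) := by
    rintro t ⟨ht0, R, hR⟩
    obtain ⟨w, -, hw⟩ := (isCompact_closedBall (0 : E) R).ultrafilter_le_nhds
      (𝒰.map fun i => y i t) (by
        rw [le_principal_iff]
        exact hR.mono fun i hi => by simpa using hi.2 t ⟨ht0, le_rfl⟩)
    exact ⟨w, hw⟩
  choose! w hw using hlim
  have hflow : ∀ t ∈ S, IsFlowOn C F w 0 t := by
    intro t ht
    obtain ⟨ht0, R, hR⟩ := id ht
    exact IsFlowOn.of_tendsto hC hA.outerSemicontinuous hA.locallyBounded hA.convex ht0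
      (hR.mono fun i hi => ⟨(hy i).mono le_rfl ht0 hi.1, hi.2⟩)
      (fun s hs => hw s (hSc t ht s hs.1 hs.2))
  obtain ⟨R, hR⟩ := hA.exists_bound_of_isFlowOn h0 hS hSc hflow
  -- `R` bounds the limit on all of `S`, so `L`, and with it the step `1 / (L + 1)`, does not depend
  -- on `t`. The radius leaves one unit for `y i t` to differ from its limit and one for the motion
  -- during the step.
  obtain ⟨L, hL0, hL⟩ := hA.locallyBounded.exists_bound_of_isCompact
    ((isCompact_closedBall (0 : E) (R + 1 + 1)).inter_left hC) inter_subset_left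
  have hstep : ∀ t ∈ S, t + 1 / (L + 1) ∈ S := by
    intro t ht
    have hpos : 0 < 1 / (L + 1) := by positivity
    obtain ⟨ht0, R', hR'⟩ := id ht
    refine ⟨by linarith, max R' (R + 1 + 1), ?_⟩
    have hnear : ∀ᶠ i in (𝒰 : Filter ℕ), ‖y i t‖ < R + 1 :=
      (hw t ht).norm.eventually_lt_const (by linarith [hR t ht])
    filter_upwards [hR', hnear, hlarge (R + 1 + 1)] with i hi hit hiT
    have hmain : ∀ b, t ≤ b → b ≤ T i → b ≤ t + 1 / (L + 1) → ‖y i b‖ ≤ R + 1 + 1 :=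
      fun b htb hbT hb => ((hy i).mono ht0 htb hbT).norm_le_add_one hL0
        (fun u hu huR => hL u ⟨hu, by simpa using huR⟩) hit.le hb b ⟨htb, le_rfl⟩
    -- `y i` cannot end during the step, because its endpoint lies outside the ball in which it is
    -- confined.
    have hlt : t + 1 / (L + 1) ≤ T i := by
      by_contra! h
      exact absurd (hmain (T i) hi.1 le_rfl h.le) (not_le.2 hiT)
    refine ⟨hlt, fun s hs => ?_⟩
    rcases le_total s t with h | h
    · exact (hi.2 s ⟨hs.1, h⟩).trans (le_max_left _ _)
    · exact (hmain s h (hs.2.trans hlt) hs.2).trans (le_max_right _ _)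
  have hall : ∀ t, 0 ≤ t → t ∈ S := by
    intro t ht
    have hn : ∀ n : ℕ, (n : ℝ) * (1 / (L + 1)) ∈ S := by
      intro n
      induction n with
      | zero => simpa using h0
      | succ n ih => rw [Nat.cast_succ, add_one_mul]; exact hstep _ ih
    obtain ⟨n, hn'⟩ := exists_nat_ge (t * (L + 1))
    refine hSc _ (hn n) t ht ?_
    rwa [mul_one_div, le_div_iff₀ (by linarith)]
  -- Contradiction: some `y i` comes within `δ` of `zs`, hence ends within `1` of it, yet has an
  -- endpoint of norm above `‖zs‖ + 1`.
  obtain ⟨δ, hδ, hstab⟩ := hA.exists_stable_of_isFlowOn one_pos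
  obtain ⟨t, ht0, ht⟩ := hA.exists_dist_le_of_isFlowOn (fun t ht => hflow t (hall t ht))
    (half_pos hδ)
  obtain ⟨-, R', hR'⟩ := hall t ht0
  have hnear : ∀ᶠ i in (𝒰 : Filter ℕ), dist (y i t) zs < δ :=
    ((hw t (hall t ht0)).dist tendsto_const_nhds).eventually_lt_const (by linarith)
  obtain ⟨i, hi, hit, hiT⟩ := (hR'.and (hnear.and (hlarge (‖zs‖ + 1)))).exists
  have h1 := hstab (y i) t (T i) hi.1 ((hy i).mono ht0 hi.1 le_rfl) hit.le
  have h2 : ‖y i (T i)‖ ≤ ‖zs‖ + ‖y i (T i) - zs‖ := by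
    simpa using norm_add_le zs (y i (T i) - zs)
  rw [dist_eq_norm] at h1
  linarith

end ModeAssumption

end

/-! ### From bounds on balls to Lagrange stability -/

/-- A sequence is dominated by a continuous, strictly increasing function. -/
theorem exists_continuous_strictMono_ge (β : ℕ → ℝ≥0) :
    ∃ α : ℝ≥0 → ℝ≥0, Continuous α ∧ StrictMono α ∧
      ∀ (s : ℝ≥0) (n : ℕ), (n : ℝ≥0) ≤ s + 1 → β n ≤ α s := by
  -- Truncated subtraction makes `f i` vanish for `s + 2 ≤ i`, so the sum is locally finite; for `i
  -- ≤ s + 1` the factor is at least `1`. The extra summand `s` below gives strict monotonicity.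
  let f : ℕ → ℝ≥0 → ℝ≥0 := fun i s => β i * (s + 2 - i)
  have hlf : LocallyFinite fun i => Function.support (f i) := by
    intro s
    refine ⟨Iio (s + 1), Iio_mem_nhds (lt_add_one s), (finite_Iio ⌈s + 3⌉₊).subset ?_⟩
    rintro i ⟨t, hti, hts : t < s + 1⟩
    have h1 : (i : ℝ≥0) < t + 2 := by
      by_contra! h
      exact hti (by simp only [f]; rw [tsub_eq_zero_of_le h, mul_zero])
    refine Nat.lt_ceil.2 (h1.trans ?_)
    have : t + 2 < s + 1 + 2 := by gcongr
    exact this.trans_eq (by ring)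
  have hfin : ∀ s, (Function.support fun i => f i s).Finite := fun s => hlf.point_finite s
  refine ⟨fun s => s + ∑ᶠ i, f i s, ?_, ?_, ?_⟩
  · refine continuous_id.add (continuous_finsum (fun i => ?_) hlf)
    exact continuous_const.mul ((continuous_id.add continuous_const).sub continuous_const)
  · intro s t hst
    refine add_lt_add_of_lt_of_le hst (finsum_le_finsum' (hfin s) (hfin t) fun i => ?_)
    exact mul_le_mul_right (tsub_le_tsub_right (add_le_add_left hst.le 2) _) _
  · intro s n hn
    calc β n = β n * 1 := (mul_one _).symm
      _ ≤ β n * (s + 2 - n) := by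
        refine mul_le_mul_right (le_tsub_of_add_le_left ?_) _
        calc (n : ℝ≥0) + 1 ≤ s + 1 + 1 := by gcongr
          _ = s + 2 := by ring
      _ ≤ ∑ᶠ i, f i s := single_le_finsum n (hfin s) fun _ => zero_le
      _ ≤ s + ∑ᶠ i, f i s := le_add_self

theorem HybridSystem.lagrangeStable_of_exists_bound {X : Type*} [NormedAddCommGroup X]
    [NormedSpace ℝ X] {H : HybridSystem X}
    (h : ∀ r : ℝ, ∃ R : ℝ, ∀ x : HybridArc X, H.IsSolution x → ‖x.init‖ ≤ r →
      ∀ p ∈ x.dom, ‖x.toFun p.1 p.2‖ ≤ R) : H.LagrangeStable := by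
  choose B hB using h
  obtain ⟨α, hαc, hαm, hα⟩ := exists_continuous_strictMono_ge fun n => (B n).toNNReal
  refine ⟨α, hαc, hαm, ?_⟩
  rintro _ x ⟨hx, rfl⟩ p hp
  have h1 := hB ⌈‖x.init‖₊⌉₊ x hx (by exact_mod_cast Nat.le_ceil ‖x.init‖₊) p hp
  refine h1.trans ((Real.le_coe_toNNReal _).trans (NNReal.coe_le_coe.2 (hα _ _ ?_)))
  exact (Nat.ceil_lt_add_one zero_le).le

/-! ### Linear images of solutions during flows -/

namespace HybridSystem.IsSolution

variable {X Y : Type*} [NormedAddCommGroup X] [NormedSpace ℝ X] [NormedAddCommGroup Y]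
  [NormedSpace ℝ Y] {H : HybridSystem X} {x : HybridArc X} {j : ℕ} {a b : ℝ}

theorem ae_hasDerivAt_comp (hx : H.IsSolution x) (hab : ∀ t ∈ Icc a b, (t, j) ∈ x.dom)
    (φ : X →L[ℝ] Y) :
    ∀ᵐ t : ℝ, t ∈ Ioo a b → ∃ v ∈ H.flowMap (x.toFun t j),
      HasDerivAt (fun s => φ (x.toFun s j)) (φ v) t := by
  have hint : Ioo a b ⊆ interior (x.interval j) :=
    interior_maximal (fun s hs => hab s (Ioo_subset_Icc_self hs)) isOpen_Ioo
  filter_upwards [hx.flow_deriv j] with t ht htm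
  obtain ⟨v, hv, hvd⟩ := ht (hint htm)
  exact ⟨v, hv, φ.hasFDerivAt.comp_hasDerivAt t hvd⟩

theorem _root_.HybridArc.absolutelyContinuousOnInterval_comp
    (x : HybridArc X) (hle : a ≤ b)
    (hab : ∀ t ∈ Icc a b, (t, j) ∈ x.dom) (φ : X →L[ℝ] Y) :
    AbsolutelyContinuousOnInterval (fun t => φ (x.toFun t j)) a b :=
  φ.lipschitz.comp_absolutelyContinuousOnInterval
    (x.locallyAbsolutelyContinuous j a b (hab a ⟨le_rfl, hle⟩) (hab b ⟨hle, le_rfl⟩))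

/-- A linear function that vanishes on the flow map is constant during flows. -/
theorem apply_eq (hx : H.IsSolution x) (hle : a ≤ b) (hab : ∀ t ∈ Icc a b, (t, j) ∈ x.dom)
    (φ : X →L[ℝ] Y) (hφ : ∀ u, ∀ v ∈ H.flowMap u, φ v = 0) :
    φ (x.toFun b j) = φ (x.toFun a j) := by
  have := (x.absolutelyContinuousOnInterval_comp hle hab φ).norm_sub_le_of_ae_hasDerivAt
    (L := 0) hle ((hx.ae_hasDerivAt_comp hab φ).mono fun s hs hsm => by
      obtain ⟨v, hv, hvd⟩ := hs hsm
      exact ⟨φ v, by rw [hφ _ v hv, norm_zero], hvd⟩)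
  rw [zero_mul] at this
  exact sub_eq_zero.1 (norm_le_zero_iff.1 this)

end HybridSystem.IsSolution

namespace SwitchedState

variable {n : ℕ}

/-- `z` as a continuous linear map. -/
noncomputable def zL : SwitchedState n →L[ℝ] EuclideanSpace ℝ (Fin n) := WithLp.fstL 2 ℝ _ _

/-- `σ` as a continuous linear map. -/
noncomputable def modeL : SwitchedState n →L[ℝ] ℝ :=
  (WithLp.fstL 2 ℝ ℝ ℝ).comp (WithLp.sndL 2 ℝ _ _)

/-- `τ` as a continuous linear map. -/
noncomputable def timerL : SwitchedState n →L[ℝ] ℝ :=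
  (WithLp.sndL 2 ℝ ℝ ℝ).comp (WithLp.sndL 2 ℝ _ _)

theorem norm_z_le (x : SwitchedState n) : ‖x.z‖ ≤ ‖x‖ := WithLp.norm_fst_le _ x

theorem norm_le (x : SwitchedState n) : ‖x‖ ≤ ‖x.z‖ + (|x.mode| + |x.timer|) := by
  have h1 := WithLp.prod_norm_sq_eq_of_L2 x
  have h2 := WithLp.prod_norm_sq_eq_of_L2 x.snd
  have h3 : ‖x.snd‖ ≤ |x.mode| + |x.timer| := by
    refine abs_le_of_sq_le_sq' ?_ (by positivity) |>.2
    rw [h2, Real.norm_eq_abs, Real.norm_eq_abs, mode, timer]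
    nlinarith [mul_nonneg (abs_nonneg x.snd.fst) (abs_nonneg x.snd.snd)]
  have h4 : ‖x‖ ≤ ‖x.z‖ + ‖x.snd‖ := by
    refine abs_le_of_sq_le_sq' ?_ (by positivity) |>.2
    rw [h1, z]
    nlinarith [mul_nonneg (norm_nonneg x.fst) (norm_nonneg x.snd)]
  linarith

end SwitchedState

/-! ### Solutions of the switched system -/

section

variable {n M N₀ : ℕ} {C : Set (EuclideanSpace ℝ (Fin n))}
  {F : ℕ → EuclideanSpace ℝ (Fin n) → Set (EuclideanSpace ℝ (Fin n))}
  {x : HybridArc (SwitchedState n)}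

open SwitchedState

theorem isClosed_modeSet (M : ℕ) : IsClosed (modeSet M) :=
  ((finite_Icc 1 M).image _).isClosed

theorem isClosed_flowSet_idealSystem (hC : IsClosed C) :
    IsClosed (idealSystem M N₀ C F).flowSet :=
  (hC.preimage zL.continuous).inter
    (((isClosed_modeSet M).preimage modeL.continuous).inter
      (isClosed_Icc.preimage timerL.continuous))

theorem jumpSet_subset_flowSet_idealSystem :
    (idealSystem M N₀ C F).jumpSet ⊆ (idealSystem M N₀ C F).flowSet :=
  fun _ hx => ⟨hx.1, hx.2.1, zero_le_one.trans hx.2.2.1, hx.2.2.2⟩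

/-- A solution is required to be in the flow set only at interior times. The right end follows from
closedness and continuity; the left end is assumed, which also covers degenerate intervals. -/
theorem mem_flowSet_of_isSolution (hC : IsClosed C) (hx : (idealSystem M N₀ C F).IsSolution x)
    {j : ℕ} {a b : ℝ} (hab : ∀ t ∈ Icc a b, (t, j) ∈ x.dom)
    (ha : x.toFun a j ∈ (idealSystem M N₀ C F).flowSet) :
    ∀ t ∈ Icc a b, x.toFun t j ∈ (idealSystem M N₀ C F).flowSet := by
  intro t ht
  rcases ht.1.eq_or_lt with rfl | hat
  · exact ha
  have hcont : ContinuousOn (fun s => x.toFun s j) (Icc a t) := by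
    simpa [uIcc_of_le ht.1] using (x.locallyAbsolutelyContinuous j a t
      (hab a ⟨le_rfl, ht.1.trans ht.2⟩) (hab t ht)).continuousOn
  have hint : Ioo a t ⊆ interior (x.interval j) :=
    interior_maximal (fun s hs => hab s ⟨hs.1.le, hs.2.le.trans ht.2⟩) isOpen_Ioo
  have hmem := ((hcont t ⟨ht.1, le_rfl⟩).mono Ioo_subset_Icc_self).mem_closure
    (s := Ioo a t) (t := (idealSystem M N₀ C F).flowSet)
    (by rw [closure_Ioo hat.ne]; exact ⟨ht.1, le_rfl⟩)
    (fun s hs => hx.flow_mem j s (hint hs))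
  rwa [(isClosed_flowSet_idealSystem hC).closure_eq] at hmem

theorem timer_eq_of_isSolution (hx : (idealSystem M N₀ C F).IsSolution x)
    {j : ℕ} {a b : ℝ} (hle : a ≤ b) (hab : ∀ t ∈ Icc a b, (t, j) ∈ x.dom) :
    (x.toFun b j).timer = (x.toFun a j).timer :=
  hx.apply_eq hle hab timerL fun _ _ hv => hv.2.2

theorem mode_eq_of_isSolution (hx : (idealSystem M N₀ C F).IsSolution x)
    {j : ℕ} {a b : ℝ} (hle : a ≤ b) (hab : ∀ t ∈ Icc a b, (t, j) ∈ x.dom) :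
    (x.toFun b j).mode = (x.toFun a j).mode :=
  hx.apply_eq hle hab modeL fun _ _ hv => hv.2.1

theorem exists_isFlowOn_of_isSolution (hC : IsClosed C)
    (hx : (idealSystem M N₀ C F).IsSolution x)
    {j : ℕ} {a b : ℝ} (hle : a ≤ b) (hab : ∀ t ∈ Icc a b, (t, j) ∈ x.dom)
    (ha : x.toFun a j ∈ (idealSystem M N₀ C F).flowSet) :
    ∃ k ∈ Icc 1 M, IsFlowOn C (F k) (fun t => (x.toFun t j).z) a b := by
  obtain ⟨k, hk, hka⟩ := ha.2.1
  have hka : (k : ℝ) = (x.toFun a j).mode := hka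
  refine ⟨k, hk, x.absolutelyContinuousOnInterval_comp hle hab zL,
    fun t ht => (mem_flowSet_of_isSolution hC hx hab ha t ht).1, ?_⟩
  filter_upwards [hx.ae_hasDerivAt_comp hab zL] with t ht htm
  -- The flow map yields an index depending on `t`; constancy of the mode identifies it with `k`.
  obtain ⟨v, ⟨⟨k', hk', hkt, hvF⟩, -⟩, hvd⟩ := ht htm
  rw [mode_eq_of_isSolution hx htm.1.le fun s hs => hab s ⟨hs.1, hs.2.trans htm.2.le⟩, ← hka,
    Nat.cast_inj] at hkt
  subst hkt
  exact ⟨v.z, hvF, hvd⟩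

theorem abs_mode_le {u : SwitchedState n} (hu : u.mode ∈ modeSet M) : |u.mode| ≤ M := by
  obtain ⟨k, hk, hku⟩ := hu
  rw [← hku, Nat.abs_cast]
  exact_mod_cast hk.2

/-- The timer allows at most `N₀` jumps, so a growth bound `B` for the modes is applied at most
`N₀ + 1` times. -/
theorem norm_le_of_isSolution (hC : IsClosed C) (hx : (idealSystem M N₀ C F).IsSolution x)
    {B : ℝ → ℝ} (hB : ∀ r, ∀ k ∈ Icc 1 M, ∀ (z : ℝ → EuclideanSpace ℝ (Fin n)) (T : ℝ), 0 ≤ T →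
      IsFlowOn C (F k) z 0 T → ‖z 0‖ ≤ r → ‖z T‖ ≤ B r)
    {r : ℝ} (hr : ‖x.init‖ ≤ r) {p : ℝ × ℕ} (hp : p ∈ x.dom) :
    ‖x.toFun p.1 p.2‖ ≤ ∑ i ∈ Finset.range (N₀ + 2), |B^[i] r| + (M + N₀) := by
  obtain ⟨t, j⟩ := p
  obtain ⟨J, τ, hτ0, hτ, hE⟩ := x.isHybridTimeDomain.2 _ hp
  have hmemE : ∀ i < J, ∀ s ∈ Icc (τ i) (τ (i + 1)), (s, i) ∈ x.dom := by
    intro i hi s hs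
    have : (s, i) ∈ x.dom ∩ Icc 0 t ×ˢ Iic j := by
      rw [hE]; exact mem_iUnion₂.2 ⟨i, hi, hs, rfl⟩
    exact this.1
  obtain ⟨hjJ, htj⟩ : j < J ∧ t ∈ Icc (τ j) (τ (j + 1)) := by
    have : (t, j) ∈ x.dom ∩ Icc 0 t ×ˢ Iic j :=
      ⟨hp, ⟨x.isHybridTimeDomain.1 _ hp, le_rfl⟩, mem_Iic.2 le_rfl⟩
    rw [hE] at this
    obtain ⟨i, hi, hs, rfl⟩ := mem_iUnion₂.1 this
    exact ⟨hi, hs⟩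
  have hflowB : ∀ i < J, x.toFun (τ i) i ∈ (idealSystem M N₀ C F).flowSet →
      ‖(x.toFun (τ i) i).z‖ ≤ B^[i] r → ∀ s ∈ Icc (τ i) (τ (i + 1)),
      x.toFun s i ∈ (idealSystem M N₀ C F).flowSet ∧
      (x.toFun s i).timer = (x.toFun (τ i) i).timer ∧ ‖(x.toFun s i).z‖ ≤ B^[i + 1] r := by
    intro i hi hmem hnorm s hs
    have hdom : ∀ u ∈ Icc (τ i) s, (u, i) ∈ x.dom :=
      fun u hu => hmemE i hi u ⟨hu.1, hu.2.trans hs.2⟩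
    obtain ⟨k, hk, hz⟩ := exists_isFlowOn_of_isSolution hC hx hs.1 hdom hmem
    refine ⟨mem_flowSet_of_isSolution hC hx hdom hmem s ⟨hs.1, le_rfl⟩,
      timer_eq_of_isSolution hx hs.1 hdom, ?_⟩
    have hz0 := hz.comp_add_const (τ i)
    rw [sub_self] at hz0
    have := hB (B^[i] r) k hk _ (s - τ i) (by linarith [hs.1]) hz0 (by simpa using hnorm)
    rw [Function.iterate_succ_apply']
    simpa using this
  -- The timer plus the number of past jumps never exceeds `N₀`; as the timer is nonnegative, this
  -- gives `j ≤ N₀`.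
  have hinv : ∀ i ≤ j, x.toFun (τ i) i ∈ (idealSystem M N₀ C F).flowSet ∧
      (x.toFun (τ i) i).timer + i ≤ N₀ ∧ ‖(x.toFun (τ i) i).z‖ ≤ B^[i] r := by
    intro i
    induction i with
    | zero =>
      intro _
      have hinit : x.init ∈ (idealSystem M N₀ C F).flowSet := by
        rcases hx.init_mem with h | h
        · rwa [(isClosed_flowSet_idealSystem hC).closure_eq] at h
        · exact jumpSet_subset_flowSet_idealSystem h
      rw [hτ0]
      exact ⟨hinit, by rw [Nat.cast_zero, add_zero]; exact hinit.2.2.2, (norm_z_le _).trans hr⟩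
    | succ i ih =>
      intro hij
      have hiJ : i + 1 < J := hij.trans_lt hjJ
      obtain ⟨h1, h2, h3⟩ := ih (by omega)
      obtain ⟨-, h5, h6⟩ := hflowB i (by omega) h1 h3 (τ (i + 1)) ⟨hτ i (by omega), le_rfl⟩
      obtain ⟨⟨hC', -, hT⟩, hz, hm, ht⟩ := hx.jump (τ (i + 1)) i
        (hmemE i (by omega) _ ⟨hτ i (by omega), le_rfl⟩)
        (hmemE (i + 1) hiJ _ ⟨le_rfl, hτ (i + 1) hiJ⟩)
      refine ⟨⟨by rwa [hz], hm.1, ?_⟩, ?_, by rwa [hz]⟩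
      · rw [ht]; exact ⟨by linarith [hT.1], by linarith [hT.2]⟩
      · rw [ht, h5]; push_cast; linarith
  obtain ⟨h1, h2, h3⟩ := hinv j le_rfl
  obtain ⟨h4, -, h6⟩ := hflowB j hjJ h1 h3 t htj
  have hjN : j ≤ N₀ := by
    have := h1.2.2.1
    exact_mod_cast (by linarith : (j : ℝ) ≤ N₀)
  -- `j` jumps allow `j + 1 ≤ N₀ + 1` flows. Summing absolute values dominates every such iterate
  -- without monotonicity or a sign for `B`.
  have hsum : |B^[j + 1] r| ≤ ∑ i ∈ Finset.range (N₀ + 2), |B^[i] r| :=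
    Finset.single_le_sum (f := fun i => |B^[i] r|) (fun _ _ => abs_nonneg _)
      (Finset.mem_range.2 (by omega))
  have htimer : |(x.toFun t j).timer| ≤ N₀ := by
    rw [abs_of_nonneg h4.2.2.1]; exact h4.2.2.2
  linarith [norm_le (x.toFun t j), abs_mode_le h4.2.1, le_abs_self (B^[j + 1] r)]

end

theorem corollary1 (n M N₀ : ℕ) (hM : 0 < M) (hN₀ : 0 < N₀)
    (C : Set (EuclideanSpace ℝ (Fin n))) (hC : IsClosed C)
    (F : ℕ → EuclideanSpace ℝ (Fin n) → Set (EuclideanSpace ℝ (Fin n)))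
    (zs : ℕ → EuclideanSpace ℝ (Fin n))
    (hA : ∀ k ∈ Set.Icc 1 M, ModeAssumption C (F k) (zs k)) :
    (idealSystem M N₀ C F).LagrangeStable := by
  have hB : ∀ r : ℝ, ∃ R : ℝ, ∀ k ∈ Icc 1 M, ∀ (z : ℝ → EuclideanSpace ℝ (Fin n)) (T : ℝ),
      0 ≤ T → IsFlowOn C (F k) z 0 T → ‖z 0‖ ≤ r → ‖z T‖ ≤ R := by
    intro r
    choose! R hR using fun k hk => (hA k hk).exists_uniform_bound hC r
    obtain ⟨R', hR'⟩ := ((finite_Icc 1 M).image R).bddAbove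
    exact ⟨R', fun k hk z T hT hz hz0 =>
      (hR k hk z T hT hz hz0).trans (hR' (mem_image_of_mem R hk))⟩
  choose B hB using hB
  exact HybridSystem.lagrangeStable_of_exists_bound fun r =>
    ⟨_, fun x hx hr p hp => norm_le_of_isSolution hC hx hB hr hp⟩
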